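/- Let $n\ge 2$ and let $N,\tau$ be positive integers with $N\ge D(n,\tau)$, where $D(n,2k-1)=2\binom{n+k-2}{n-1}$ and $D(n,2k)=\binom{n+k-1}{n-1}+\binom{n+k-2}{n-1}$ for $k\ge 1$. Let $h:[-1,1]\to[0,+\infty]$ be any function. A spherical $\tau$-design is a finite set $C\subset\mathbb S^{n-1}\subset\mathbb R^n$ such that, for all real polynomials $f(x_1,\dots,x_n)$ of total degree at most $\tau$, the average of $f$ over $\mathbb S^{n-1}$ with respect to surface measure equals $\frac1{|C|}\sum_{x\in C}f(x)$. Put $$E(n,C;h)=\sum_{x,y\in C,\ x\ne y}h(\langle x,y\rangle),$$ and let $\mathcal U(n,N,\tau;h)$ be the supremum of $E(n,C;h)$ over all spherical $\tau$-designs $C\subset\mathbb S^{n-1}$ with $|C|=N$. Let $u(n,N,\tau)$ be the supremum of $\max\{\langle x,y\rangle: x,y\in C,\ x\neq y\}$ and $\ell(n,N,\tau)$ the infimum of $\min\{\langle x,y\rangle: x,y\in C,\ x\neq y\}$ over the same designs (with $\sup\emptyset=-\infty$ and $\inf\emptyset=+\infty$). Let $P_i^{(n)}$ be the Gegenbauer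 polynomials, given by $P_0^{(n)}(t)=1$, $P_1^{(n)}(t)=t$ and $$(i+n-2)P_{i+1}^{(n)}(t)=(2i+n-2)\,t\,P_i^{(n)}(t)-i\,P_{i-1}^{(n)}(t)\qquad(i\ge 1),$$ and let $g(t)=\sum_{i=0}^{\deg g}g_iP_i^{(n)}(t)$ be a real polynomial with $g_i\le 0$ for all $i\ge\tau+1$. (a) Let $I\subseteq[-1,1)$ be such that $g(t)\ge h(t)$ for all $t\in I$. If $C\subset\mathbb S^{n-1}$ is a spherical $\tau$-design with $|C|=N$ and $\langle x,y\rangle\in I$ for all distinct $x,y\in C$, then $$E(n,C;h)\le N\bigl(g_0N-g(1)\bigr).$$ (b) If $g(t)\ge h(t)$ for all $t\in[\ell(n,N,\tau),u(n,N,\tau)]$, then $$\mathcal U(n,N,\tau;h)\le N\bigl(g_0N-g(1)\bigr).$$ -/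

import Mathlib

open scoped ENNReal Polynomial

namespace SphericalDesign

/-- The unit sphere `S^{n-1}` of the Euclidean space `ℝ^n`. -/
abbrev Sphere (n : ℕ) : Type :=
  Metric.sphere (0 : EuclideanSpace ℝ (Fin n)) 1

/-- The inner product of two points of the unit sphere, as a point of `[-1, 1]`. -/
noncomputable def ip {n : ℕ} (x y : Sphere n) : Set.Icc (-1 : ℝ) 1 :=
  ⟨inner ℝ (x : EuclideanSpace ℝ (Fin n)) (y : EuclideanSpace ℝ (Fin n)), by
    have h := abs_real_inner_le_norm (x : EuclideanSpace ℝ (Fin n)) (y : EuclideanSpace ℝ (Fin n))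
    rw [norm_eq_of_mem_sphere x, norm_eq_of_mem_sphere y, one_mul] at h
    exact abs_le.mp h⟩

/-- The Gegenbauer polynomials `P_i^{(n)}`, normalized by `P_i^{(n)}(1) = 1`: `P_0 = 1`, `P_1 = t`,
`(i + n - 2) P_{i+1} = (2 i + n - 2) t P_i - i P_{i-1}` for `i ≥ 1`; meant for `n ≥ 2`, where the
leading factor `i + n - 2` is positive. The third clause is the recurrence with `i + 1` for `i`. -/
noncomputable def gegenbauer (n : ℕ) : ℕ → ℝ[X]
  | 0 => 1
  | 1 => Polynomial.X
  | i + 2 =>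
    Polynomial.C (((i : ℝ) + 1 + n - 2)⁻¹) *
      (Polynomial.C (2 * ((i : ℝ) + 1) + n - 2) * Polynomial.X * gegenbauer n (i + 1)
        - Polynomial.C ((i : ℝ) + 1) * gegenbauer n i)

/-- The finite set `C ⊂ S^{n-1}` is a spherical `τ`-design: for every real polynomial in `n`
variables of total degree at most `τ`, its mean over the sphere with respect to the surface
measure equals its mean over `C`. -/
def IsDesign {n : ℕ} (τ : ℕ) (C : Finset (Sphere n)) : Prop :=
  ∀ f : MvPolynomial (Fin n) ℝ, f.totalDegree ≤ τ →
    (1 / (MeasureTheory.volume : MeasureTheory.Measure (EuclideanSpace ℝ (Fin n))).toSphere.real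
        Set.univ) *
      ∫ x : Sphere n, MvPolynomial.eval (fun i => (x : EuclideanSpace ℝ (Fin n)) i) f
        ∂(MeasureTheory.volume : MeasureTheory.Measure (EuclideanSpace ℝ (Fin n))).toSphere
      = (1 / (C.card : ℝ)) *
        ∑ x ∈ C, MvPolynomial.eval (fun i => (x : EuclideanSpace ℝ (Fin n)) i) f

open Classical in
/-- The `h`-energy of `C`: the sum of `h(⟨x, y⟩)` over ordered pairs of distinct points. -/
noncomputable def energy {n : ℕ} (C : Finset (Sphere n)) (h : Set.Icc (-1 : ℝ) 1 → ℝ≥0∞) : ℝ≥0∞ :=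
  ∑ p ∈ C.offDiag, h (ip p.1 p.2)

/-- The largest `h`-energy of a `τ`-design of `N` points on `S^{n-1}`: a supremum of extended real
numbers, equal to `-∞` if there is no such design. -/
noncomputable def maxEnergy (n N τ : ℕ) (h : Set.Icc (-1 : ℝ) 1 → ℝ≥0∞) : EReal :=
  sSup {e : EReal | ∃ C : Finset (Sphere n), IsDesign τ C ∧ C.card = N ∧ e = (energy C h : EReal)}

open Classical in
/-- `u(C)`, the maximum of the inner products of distinct points of `C`. -/
noncomputable def maxInner {n : ℕ} (C : Finset (Sphere n)) : EReal :=
  C.offDiag.sup fun p => ((ip p.1 p.2 : ℝ) : EReal)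

open Classical in
/-- `ℓ(C)`, the minimum of the inner products of distinct points of `C`. -/
noncomputable def minInner {n : ℕ} (C : Finset (Sphere n)) : EReal :=
  C.offDiag.inf fun p => ((ip p.1 p.2 : ℝ) : EReal)

/-- `u(n, N, τ)`: the supremum of `u(C)` over the `τ`-designs of `N` points on `S^{n-1}`. -/
noncomputable def upperInner (n N τ : ℕ) : EReal :=
  sSup {s : EReal | ∃ C : Finset (Sphere n), IsDesign τ C ∧ C.card = N ∧ s = maxInner C}

/-- `ℓ(n, N, τ)`: the infimum of `ℓ(C)` over the `τ`-designs of `N` points on `S^{n-1}`. -/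
noncomputable def lowerInner (n N τ : ℕ) : EReal :=
  sInf {s : EReal | ∃ C : Finset (Sphere n), IsDesign τ C ∧ C.card = N ∧ s = minInner C}

/-- The real interval `[ℓ(n, N, τ), u(n, N, τ)]`. -/
def innerInterval (n N τ : ℕ) : Set ℝ :=
  {t : ℝ | lowerInner n N τ ≤ (t : EReal) ∧ (t : EReal) ≤ upperInner n N τ}

/-- The Delsarte–Goethals–Seidel number `D(n, τ)`, which is `C(n+k-1, n-1) + C(n+k-2, n-1)` for
`τ = 2k` and `2 C(n+k-2, n-1)` for `τ = 2k - 1`. -/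
def dgs (n τ : ℕ) : ℕ :=
  if Even τ then (n + τ / 2 - 1).choose (n - 1) + (n + τ / 2 - 2).choose (n - 1)
  else 2 * (n + (τ + 1) / 2 - 2).choose (n - 1)

end SphericalDesign

/-! ### The Fischer form and its adjoint operators -/

namespace SphericalDesign

open MvPolynomial

variable {σ : Type*}

/-! This is the linear programming bound. Summing `g` over all ordered pairs of `C`, the diagonal
gives `N g(1)` and the rest dominates the energy. In the Gegenbauer expansion the degree 0 term
gives `c 0 * N ^ 2`, degrees 1 to `τ` vanish because `C` is a design (`sum_gegenbauer_eq_zero`), and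
higher degrees contribute at most 0, since `c i ≤ 0` and Gegenbauer kernels are positive definite
(`sum_gegenbauer_nonneg`).

Positive definiteness is algebraic: the zonal harmonic at `x` represents, up to a positive constant,
evaluation at `x` on harmonic forms for the Fischer form (`exists_fischer_zonal`), so the double sum
of the kernel is a positive multiple of a Fischer square.

Vanishing needs the spherical mean of `P_i(⟨x, y⟩)` to be 0 for `i ≥ 1`. Rotation invariance gives
an integration by parts formula (`sphereFunctional_derivative`), which with the Gegenbauer
recurrences determines these means (`sphereFunctional_gegenbauer`). -/

/-- The Fischer form `⟨p, q⟩ = ∑ α, α! p_α q_α` on real polynomials. -/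
noncomputable def fischer : MvPolynomial σ ℝ →ₗ[ℝ] MvPolynomial σ ℝ →ₗ[ℝ] ℝ :=
  (basisMonomials σ ℝ).constr ℝ fun α => (α.prod fun _ k => (k.factorial : ℝ)) • lcoeff ℝ α

theorem fischer_monomial (α : σ →₀ ℕ) (a : ℝ) (q : MvPolynomial σ ℝ) :
    fischer (monomial α a) q = a * ((α.prod fun _ k => (k.factorial : ℝ)) * q.coeff α) := by
  have h : monomial α a = a • basisMonomials σ ℝ α := by
    simp [coe_basisMonomials, smul_monomial]
  rw [h, map_smul, fischer, Module.Basis.constr_basis]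
  simp [lcoeff]

theorem fischer_self_nonneg (p : MvPolynomial σ ℝ) : 0 ≤ fischer p p := by
  conv_rhs => enter [1]; rw [p.as_sum]
  rw [map_sum, LinearMap.sum_apply]
  refine Finset.sum_nonneg fun α _ => ?_
  rw [fischer_monomial]
  have : 0 ≤ (α.prod fun _ k => (k.factorial : ℝ)) :=
    Finset.prod_nonneg fun _ _ => by positivity
  nlinarith [mul_nonneg this (mul_self_nonneg (coeff α p))]

theorem prod_factorial_add_single (α : σ →₀ ℕ) (j : σ) :
    ((α + Finsupp.single j 1).prod fun _ k => (k.factorial : ℝ)) =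
      (α j + 1) * α.prod fun _ k => (k.factorial : ℝ) := by
  classical
  have key : ∀ β : σ →₀ ℕ, (β.prod fun _ k => (k.factorial : ℝ)) =
      (β j).factorial * (β.erase j).prod fun _ k => (k.factorial : ℝ) := fun β =>
    (Finsupp.mul_prod_erase' β j (fun _ k => (k.factorial : ℝ)) (by simp)).symm
  rw [key, key α, Finsupp.erase_add, Finsupp.erase_single, add_zero]
  simp [Nat.factorial_succ]
  ring

/-- On monomials, raising the `j`-th exponent multiplies `α!` by `α j + 1`, exactly the factor
produced by differentiation. -/
theorem fischer_X_mul (j : σ) (p q : MvPolynomial σ ℝ) :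
    fischer (X j * p) q = fischer p (pderiv j q) := by
  induction p using MvPolynomial.induction_on' with
  | monomial α a =>
    rw [X, monomial_mul, fischer_monomial, fischer_monomial, coeff_pderiv, add_comm,
      prod_factorial_add_single]
    ring
  | add p q hp hq => rw [mul_add, map_add, map_add, LinearMap.add_apply, hp, hq, LinearMap.add_apply]

theorem pderiv_comm (i j : σ) (p : MvPolynomial σ ℝ) :
    pderiv i (pderiv j p) = pderiv j (pderiv i p) := by
  classical
  ext m
  simp only [coeff_pderiv]
  by_cases h : i = j
  · subst h; rfl
  · simp [add_right_comm, h, Ne.symm h]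
    ring

theorem fischer_C_mul (a : ℝ) (p q : MvPolynomial σ ℝ) :
    fischer (C a * p) q = a * fischer p q := by
  rw [C_mul', map_smul]; rfl

variable [Fintype σ]

/-- The derivative in the direction `y`. -/
noncomputable def dirDeriv (y : σ → ℝ) :
    Derivation ℝ (MvPolynomial σ ℝ) (MvPolynomial σ ℝ) :=
  ∑ j, y j • pderiv j

noncomputable def laplacian (p : MvPolynomial σ ℝ) : MvPolynomial σ ℝ :=
  ∑ j, pderiv j (pderiv j p)

/-- The linear form `⟨y, ·⟩`. -/
noncomputable def linForm (y : σ → ℝ) : MvPolynomial σ ℝ := ∑ j, C (y j) * X j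

variable (σ) in
/-- The squared norm as a polynomial. -/
noncomputable def normSq : MvPolynomial σ ℝ := ∑ j, X j * X j

theorem dirDeriv_apply (y : σ → ℝ) (p : MvPolynomial σ ℝ) :
    dirDeriv y p = ∑ j, C (y j) * pderiv j p := by
  have h := congrFun (map_sum (Derivation.coeFnAddMonoidHom
    (R := ℝ) (A := MvPolynomial σ ℝ) (M := MvPolynomial σ ℝ))
    (fun j => y j • pderiv j) Finset.univ) p
  rw [Finset.sum_apply] at h
  refine h.trans (Finset.sum_congr rfl fun j _ => ?_)
  rw [C_mul']
  rfl

theorem fischer_linForm_mul (y : σ → ℝ) (p q : MvPolynomial σ ℝ) :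
    fischer (linForm y * p) q = fischer p (dirDeriv y q) := by
  rw [linForm, Finset.sum_mul, map_sum, LinearMap.sum_apply, dirDeriv_apply, map_sum]
  refine Finset.sum_congr rfl fun j _ => ?_
  rw [mul_assoc, fischer_C_mul, fischer_X_mul, C_mul', map_smul, smul_eq_mul]

theorem fischer_normSq_mul (p q : MvPolynomial σ ℝ) :
    fischer (normSq σ * p) q = fischer p (laplacian q) := by
  rw [normSq, Finset.sum_mul, map_sum, LinearMap.sum_apply, laplacian, map_sum]
  refine Finset.sum_congr rfl fun j _ => ?_
  rw [mul_assoc, fischer_X_mul, fischer_X_mul]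

theorem pderiv_linForm (y : σ → ℝ) (j : σ) : pderiv j (linForm y) = C (y j) := by
  classical
  simp [linForm, pderiv_X, Pi.single_apply]

theorem pderiv_normSq (j : σ) : pderiv j (normSq σ) = 2 * X j := by
  classical
  simp [normSq, pderiv_X, Pi.single_apply, Finset.sum_add_distrib, two_mul]

theorem dirDeriv_linForm (x y : σ → ℝ) : dirDeriv x (linForm y) = C (∑ j, x j * y j) := by
  simp [dirDeriv_apply, pderiv_linForm]

theorem dirDeriv_normSq (x : σ → ℝ) : dirDeriv x (normSq σ) = 2 * linForm x := by
  simp only [dirDeriv_apply, pderiv_normSq, linForm, Finset.mul_sum]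
  exact Finset.sum_congr rfl fun j _ => by ring

theorem laplacian_C_mul (a : ℝ) (p : MvPolynomial σ ℝ) :
    laplacian (C a * p) = C a * laplacian p := by
  simp [laplacian, Finset.mul_sum]

theorem laplacian_sub (p q : MvPolynomial σ ℝ) :
    laplacian (p - q) = laplacian p - laplacian q := by
  simp [laplacian]

theorem laplacian_dirDeriv (y : σ → ℝ) (p : MvPolynomial σ ℝ) :
    laplacian (dirDeriv y p) = dirDeriv y (laplacian p) := by
  simp only [laplacian, dirDeriv_apply, map_sum, pderiv_C_mul]
  refine Finset.sum_congr rfl fun j _ => Finset.sum_congr rfl fun i _ => ?_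
  rw [pderiv_comm j i p, pderiv_comm j i (pderiv j p)]

theorem laplacian_linForm_mul (y : σ → ℝ) (p : MvPolynomial σ ℝ) :
    laplacian (linForm y * p) = 2 * dirDeriv y p + linForm y * laplacian p := by
  simp only [laplacian, dirDeriv_apply, Finset.mul_sum, ← Finset.sum_add_distrib]
  refine Finset.sum_congr rfl fun j _ => ?_
  simp only [pderiv_mul, map_add, pderiv_linForm, pderiv_C]
  ring

theorem laplacian_normSq_mul (p : MvPolynomial σ ℝ) :
    laplacian (normSq σ * p) =
      2 * (Fintype.card σ : MvPolynomial σ ℝ) * p + 4 * (∑ j, X j * pderiv j p) +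
        normSq σ * laplacian p := by
  have h : ∀ j, pderiv j (pderiv j (normSq σ * p)) =
      2 * p + 4 * (X j * pderiv j p) + normSq σ * pderiv j (pderiv j p) := by
    intro j
    have h2 : pderiv j (2 : MvPolynomial σ ℝ) = 0 := by
      exact_mod_cast (pderiv j).map_natCast 2
    simp only [pderiv_mul, map_add, pderiv_normSq, pderiv_X_self, h2]
    ring
  simp only [laplacian, h, Finset.sum_add_distrib, Finset.mul_sum]
  simp only [Finset.sum_const, Finset.card_univ, nsmul_eq_mul]
  ring

theorem dirDeriv_isHomogeneous (y : σ → ℝ) {p : MvPolynomial σ ℝ} {k : ℕ}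
    (hp : p.IsHomogeneous (k + 1)) : (dirDeriv y p).IsHomogeneous k := by
  rw [dirDeriv_apply]
  refine IsHomogeneous.sum _ _ _ fun j _ => ?_
  simpa using (isHomogeneous_C σ (y j)).mul (hp.pderiv (i := j))

theorem euler_eval {p : MvPolynomial σ ℝ} {k : ℕ} (hp : p.IsHomogeneous k) (x : σ → ℝ) :
    eval x (dirDeriv x p) = k * eval x p := by
  have := congrArg (eval x) hp.sum_X_mul_pderiv
  simpa [dirDeriv_apply] using this

end SphericalDesign

/-! ### Zonal harmonics -/

namespace SphericalDesign

open MvPolynomial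

/-- The zonal harmonic `|x|^i P_i^{(n)}(⟨x, y⟩ / |x|)` of a unit vector `y`, as a polynomial in `x`,
defined by the homogenized Gegenbauer recurrence. -/
noncomputable def zonal {n : ℕ} (y : Fin n → ℝ) : ℕ → MvPolynomial (Fin n) ℝ
  | 0 => 1
  | 1 => linForm y
  | i + 2 =>
    C (((i : ℝ) + 1 + n - 2)⁻¹) *
      (C (2 * ((i : ℝ) + 1) + n - 2) * (linForm y * zonal y (i + 1))
        - C ((i : ℝ) + 1) * (normSq (Fin n) * zonal y i))

variable {n : ℕ}

theorem linForm_isHomogeneous (y : Fin n → ℝ) : (linForm y).IsHomogeneous 1 :=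
  IsHomogeneous.sum _ _ _ fun j _ => by
    simpa using (isHomogeneous_C (Fin n) (y j)).mul (isHomogeneous_X ℝ j)

theorem normSq_isHomogeneous : (normSq (Fin n)).IsHomogeneous 2 :=
  IsHomogeneous.sum _ _ _ fun j _ => (isHomogeneous_X ℝ j).mul (isHomogeneous_X ℝ j)

theorem zonal_isHomogeneous (y : Fin n → ℝ) : ∀ i, (zonal y i).IsHomogeneous i
  | 0 => isHomogeneous_one _ _
  | 1 => linForm_isHomogeneous y
  | i + 2 => by
    have h1 := (linForm_isHomogeneous y).mul (zonal_isHomogeneous y (i + 1))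
    have h0 := (normSq_isHomogeneous (n := n)).mul (zonal_isHomogeneous y i)
    rw [show 1 + (i + 1) = i + 2 by ring] at h1
    rw [add_comm 2 i] at h0
    rw [zonal]
    exact ((h1.C_mul _).sub (h0.C_mul _)).C_mul _

theorem C_mul_zonal_add_two (hn : 2 ≤ n) (y : Fin n → ℝ) (i : ℕ) :
    C ((i : ℝ) + 1 + n - 2) * zonal y (i + 2) =
      C (2 * ((i : ℝ) + 1) + n - 2) * (linForm y * zonal y (i + 1))
        - C ((i : ℝ) + 1) * (normSq (Fin n) * zonal y i) := by
  have : (2 : ℝ) ≤ n := by exact_mod_cast hn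
  have h0 : (i : ℝ) + 1 + n - 2 ≠ 0 := by
    have := i.cast_nonneg (α := ℝ)
    linarith
  rw [zonal, ← mul_assoc, ← C_mul, mul_inv_cancel₀ h0, C_1, one_mul]

theorem dirDeriv_zonal (hn : 2 ≤ n) {y : Fin n → ℝ} (hy : ∑ j, y j * y j = 1) (i : ℕ) :
    dirDeriv y (zonal y (i + 1)) = C ((i : ℝ) + 1) * zonal y i := by
  have hn' : (2 : ℝ) ≤ n := by exact_mod_cast hn
  have dC : ∀ (a : ℝ) p, dirDeriv y (C a * p) = C a * dirDeriv y p := fun a p => by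
    rw [C_mul', Derivation.map_smul, C_mul']
  have cancel : ∀ (a : ℝ) (p q : MvPolynomial (Fin n) ℝ), a ≠ 0 → C a * p = C a * q → p = q :=
    fun a p q ha h => mul_left_cancel₀ (by simpa using ha) h
  induction i using Nat.twoStepInduction with
  | zero => simp [zonal, dirDeriv_linForm, hy]
  | one =>
    refine cancel ((0 : ℕ) + 1 + n - 2) _ _ (by push_cast; linarith) ?_
    rw [← dC, C_mul_zonal_add_two hn, map_sub, dC, dC, Derivation.leibniz, Derivation.leibniz,
      dirDeriv_normSq]
    simp only [zonal, dirDeriv_linForm, hy, smul_eq_mul, Derivation.map_one_eq_zero]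
    simp only [map_add, map_sub, map_mul, map_natCast, map_one, map_ofNat]
    push_cast
    ring
  | more i h0 h1 =>
    refine cancel ((i + 1 : ℕ) + 1 + n - 2) _ _ (by push_cast; linarith) ?_
    have hr := C_mul_zonal_add_two hn y i
    rw [← dC, C_mul_zonal_add_two hn, map_sub, dC, dC, Derivation.leibniz, Derivation.leibniz,
      dirDeriv_normSq, dirDeriv_linForm, hy, h0, h1]
    simp only [smul_eq_mul]
    simp only [map_add, map_sub, map_mul, map_natCast, map_one, map_ofNat] at hr ⊢
    push_cast
    -- The term `2 * linForm y` from differentiating `normSq` lowers the coefficient `2i + n + 2` to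
    -- `2i + n`, so the previous recurrence applies.
    linear_combination (-(i : MvPolynomial (Fin n) ℝ) - 2) * hr

end SphericalDesign

/-! ### Harmonicity, the reproducing property and positive definiteness -/

namespace SphericalDesign

open MvPolynomial
variable {n : ℕ}

/-- In the recurrence, the linear-form term contributes `(2i + n) * 2(i + 1)` times `zonal y i`, and
the `normSq` term, by Euler's identity, `(i + 1) * (2n + 4i)` times it; these cancel. -/
theorem laplacian_zonal (hn : 2 ≤ n) {y : Fin n → ℝ} (hy : ∑ j, y j * y j = 1) (i : ℕ) :
    laplacian (zonal y i) = 0 := by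
  have hn' : (2 : ℝ) ≤ n := by exact_mod_cast hn
  induction i using Nat.twoStepInduction with
  | zero => simp [zonal, laplacian]
  | one => simp [zonal, laplacian, pderiv_linForm]
  | more i h0 h1 =>
    have ha : (C ((i : ℝ) + 1 + n - 2) : MvPolynomial (Fin n) ℝ) ≠ 0 := by
      have := i.cast_nonneg (α := ℝ)
      simp only [ne_eq, C_eq_zero]
      linarith
    refine mul_left_cancel₀ ha ?_
    rw [← laplacian_C_mul, C_mul_zonal_add_two hn, laplacian_sub, laplacian_C_mul,
      laplacian_C_mul, laplacian_linForm_mul, laplacian_normSq_mul, h0, h1, dirDeriv_zonal hn hy,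
      (zonal_isHomogeneous y i).sum_X_mul_pderiv]
    simp only [map_add, map_sub, map_mul, map_natCast, map_one, map_ofNat, nsmul_eq_mul,
      Fintype.card_fin]
    ring

/-- The adjoint of `normSq` is the Laplacian, which kills `W`. The adjoint of `linForm x` is
`dirDeriv x`, which preserves harmonicity and lowers the degree; Euler's identity then returns to
`W`. The constant `b` must not depend on `x`, so that it factors out of sums over points. -/
theorem exists_fischer_zonal (hn : 2 ≤ n) (i : ℕ) :
    ∃ b : ℝ, 0 < b ∧ ∀ (x : Fin n → ℝ) (W : MvPolynomial (Fin n) ℝ), W.IsHomogeneous i →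
      laplacian W = 0 → fischer (zonal x i) W = b * eval x W := by
  have hn' : (2 : ℝ) ≤ n := by exact_mod_cast hn
  have h_zero : ∀ (x : Fin n → ℝ) (W : MvPolynomial (Fin n) ℝ), W.IsHomogeneous 0 →
      fischer (zonal x 0) W = 1 * eval x W := fun x W hW => by
    obtain ⟨a, rfl⟩ : ∃ a, W = C a :=
      ⟨_, totalDegree_eq_zero_iff_eq_C.1 ((totalDegree_zero_iff_isHomogeneous _).2 hW)⟩
    rw [zonal, ← C_1, ← monomial_zero', fischer_monomial]
    simp
  induction i using Nat.twoStepInduction with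
  | zero => exact ⟨1, one_pos, fun x W hW _ => h_zero x W hW⟩
  | one =>
    refine ⟨1, one_pos, fun x W hW _ => ?_⟩
    have h := h_zero x _ (dirDeriv_isHomogeneous x (k := 0) hW)
    rw [euler_eval hW] at h
    rw [zonal, ← mul_one (linForm x), fischer_linForm_mul]
    simpa [zonal] using h
  | more i _ h1 =>
    obtain ⟨b, hb, h⟩ := h1
    have hi := i.cast_nonneg (α := ℝ)
    have ha : 0 < (i : ℝ) + 1 + n - 2 := by linarith
    have ha' : 0 < 2 * ((i : ℝ) + 1) + n - 2 := by linarith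
    refine ⟨((i : ℝ) + 1 + n - 2)⁻¹ * ((2 * ((i : ℝ) + 1) + n - 2) * (b * (i + 2))),
      by positivity, fun x W hW hΔ => ?_⟩
    rw [zonal, fischer_C_mul, map_sub, LinearMap.sub_apply, fischer_C_mul, fischer_C_mul,
      fischer_linForm_mul, fischer_normSq_mul, hΔ, h x _ (dirDeriv_isHomogeneous x hW)
        (by rw [laplacian_dirDeriv, hΔ, map_zero]), euler_eval hW]
    push_cast
    simp only [map_zero]
    ring

theorem eval_linForm (x y : Fin n → ℝ) : eval x (linForm y) = ∑ j, x j * y j := by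
  simp [linForm, mul_comm]

theorem eval_zonal {x : Fin n → ℝ} (hx : ∑ j, x j * x j = 1) (y : Fin n → ℝ) (i : ℕ) :
    eval x (zonal y i) = (gegenbauer n i).eval (∑ j, x j * y j) := by
  have hN : eval x (normSq (Fin n)) = 1 := by simpa [normSq] using hx
  induction i using Nat.twoStepInduction with
  | zero => simp [zonal, gegenbauer]
  | one => simp [zonal, gegenbauer, eval_linForm]
  | more i h0 h1 =>
    rw [zonal, gegenbauer]
    simp only [eval_C, Polynomial.eval_C, map_mul, map_sub, Polynomial.eval_mul,
      Polynomial.eval_sub, Polynomial.eval_X, h0, h1, hN, eval_linForm]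
    ring

theorem sum_mul_self_sphere (x : Sphere n) : ∑ j, x.1 j * x.1 j = 1 := by
  have h := norm_eq_of_mem_sphere x
  have h2 := EuclideanSpace.real_norm_sq_eq x.1
  rw [h] at h2
  simpa [sq] using h2.symm

theorem ip_eq_sum (x y : Sphere n) : (ip x y : ℝ) = ∑ j, x.1 j * y.1 j := by
  simp [ip, PiLp.inner_apply, mul_comm]

theorem eval_zonal_sphere (x y : Sphere n) (i : ℕ) :
    eval (fun j => x.1 j) (zonal (fun j => y.1 j) i) = (gegenbauer n i).eval (ip x y : ℝ) := by
  rw [eval_zonal (sum_mul_self_sphere x), ip_eq_sum]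

/-- The Gegenbauer polynomials are positive definite on the sphere. -/
theorem sum_gegenbauer_nonneg (hn : 2 ≤ n) (C : Finset (Sphere n)) (i : ℕ) :
    0 ≤ ∑ y ∈ C, ∑ x ∈ C, (gegenbauer n i).eval (ip x y : ℝ) := by
  obtain ⟨b, hb, h⟩ := exists_fischer_zonal hn i
  refine nonneg_of_mul_nonneg_right (a := b) ?_ hb
  have key := fischer_self_nonneg (∑ x ∈ C, zonal (fun j => x.1 j) i)
  simp only [map_sum, LinearMap.sum_apply] at key
  refine key.trans_eq ?_
  rw [Finset.mul_sum]
  refine Finset.sum_congr rfl fun y _ => ?_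
  rw [Finset.mul_sum]
  refine Finset.sum_congr rfl fun x _ => ?_
  rw [h _ _ (zonal_isHomogeneous _ i) (laplacian_zonal hn (sum_mul_self_sphere y) i),
    eval_zonal_sphere]

end SphericalDesign

/-! ### Integration over the sphere -/

namespace SphericalDesign

open MeasureTheory Set
open scoped Pointwise

section Sphere

variable {E : Type*} [NormedAddCommGroup E] [InnerProductSpace ℝ E]

/-- A linear isometry as a homeomorphism of the unit sphere. -/
noncomputable def sphereHomeomorph (φ : E ≃ₗᵢ[ℝ] E) :
    Metric.sphere (0 : E) 1 ≃ₜ Metric.sphere (0 : E) 1 :=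
  φ.toHomeomorph.subtype fun x => by simp

theorem coe_sphereHomeomorph (φ : E ≃ₗᵢ[ℝ] E) (x : Metric.sphere (0 : E) 1) :
    (sphereHomeomorph φ x : E) = φ x := rfl

variable [FiniteDimensional ℝ E] [MeasurableSpace E] [BorelSpace E]

/-- `toSphere` measures a set by the volume of the cone over it, and a linear isometry commutes with
forming cones and preserves volume. -/
theorem measurePreserving_sphereHomeomorph (φ : E ≃ₗᵢ[ℝ] E) :
    MeasurePreserving (sphereHomeomorph φ) (volume : Measure E).toSphere
      (volume : Measure E).toSphere := by
  refine ⟨(sphereHomeomorph φ).continuous.measurable, Measure.ext fun s hs => ?_⟩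
  have hm := (sphereHomeomorph φ).continuous.measurable
  rw [Measure.map_apply hm hs, Measure.toSphere_apply' _ (hm hs), Measure.toSphere_apply' _ hs]
  have himg : ((↑) '' (sphereHomeomorph φ ⁻¹' s) : Set E) = φ ⁻¹' ((↑) '' s) := by
    ext x
    constructor
    · rintro ⟨y, hy, rfl⟩
      exact ⟨_, hy, rfl⟩
    · rintro ⟨z, hz, hzx⟩
      have hx : x ∈ Metric.sphere (0 : E) 1 := by
        have := z.2
        rw [hzx] at this
        simpa using this
      exact ⟨⟨x, hx⟩, by
        rw [mem_preimage]
        convert hz using 1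
        exact Subtype.ext hzx.symm, rfl⟩
  have hsmul : Ioo (0 : ℝ) 1 • (φ ⁻¹' ((↑) '' s : Set E)) =
      φ ⁻¹' (Ioo (0 : ℝ) 1 • ((↑) '' s : Set E)) := by
    ext x
    simp only [mem_smul, mem_preimage]
    constructor
    · rintro ⟨r, hr, z, hz, rfl⟩
      exact ⟨r, hr, _, hz, by simp⟩
    · rintro ⟨r, hr, z, hz, h⟩
      exact ⟨r, hr, φ.symm z, by simpa using hz, by rw [← map_smul, h]; simp⟩
  rw [himg, hsmul]
  congr 1
  exact φ.measurePreserving.measure_preimage_equiv (f := φ.toHomeomorph.toMeasurableEquiv) _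

theorem integrable_sphere {f : Metric.sphere (0 : E) 1 → ℝ} (hf : Continuous f) :
    Integrable f (volume : Measure E).toSphere :=
  hf.integrable_of_hasCompactSupport (HasCompactSupport.of_compactSpace f)

theorem hasDerivAt_integral_sphere {F F' : ℝ → Metric.sphere (0 : E) 1 → ℝ}
    (hF : Continuous (Function.uncurry F)) (hF' : Continuous (Function.uncurry F'))
    (hd : ∀ θ x, HasDerivAt (F · x) (F' θ x) θ) (θ₀ : ℝ) :
    HasDerivAt (fun θ => ∫ x, F θ x ∂(volume : Measure E).toSphere)
      (∫ x, F' θ₀ x ∂(volume : Measure E).toSphere) θ₀ := by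
  have hcF : ∀ θ, Continuous (F θ) := fun θ => hF.comp (Continuous.prodMk_right θ)
  have hcF' : ∀ θ, Continuous (F' θ) := fun θ => hF'.comp (Continuous.prodMk_right θ)
  obtain ⟨K, hK⟩ := ((isCompact_closedBall θ₀ 1).prod
    (isCompact_univ (X := Metric.sphere (0 : E) 1))).exists_bound_of_continuousOn hF'.continuousOn
  exact (hasDerivAt_integral_of_dominated_loc_of_deriv_le (bound := fun _ => K)
    (Metric.closedBall_mem_nhds θ₀ one_pos)
    (Filter.Eventually.of_forall fun θ => (integrable_sphere (hcF θ)).aestronglyMeasurable)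
    (integrable_sphere (hcF θ₀)) (integrable_sphere (hcF' θ₀)).aestronglyMeasurable
    (Filter.Eventually.of_forall fun x θ hθ => hK (θ, x) ⟨hθ, mem_univ _⟩)
    (integrable_const K) (Filter.Eventually.of_forall fun x θ _ => hd θ x)).2

/-- Reflection in the hyperplane orthogonal to `e` fixes `y` and changes the sign of the integrand.
-/
theorem integral_sphere_mul_inner_eq_zero (q : ℝ[X]) {y e : E} (h : inner ℝ y e = 0) :
    ∫ x : Metric.sphere (0 : E) 1, q.eval (inner ℝ (x : E) y) * inner ℝ (x : E) e
      ∂(volume : Measure E).toSphere = 0 := by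
  set φ : E ≃ₗᵢ[ℝ] E := (ℝ ∙ e)ᗮ.reflection with hφ
  have he : φ e = -e := Submodule.reflection_orthogonalComplement_singleton_eq_neg e
  have hy : φ y = y := Submodule.reflection_mem_subspace_eq_self
    (Submodule.mem_orthogonal_singleton_iff_inner_left.2 h)
  have hi : ∀ x z : E, inner ℝ (φ x) z = inner ℝ x (φ z) := fun x z => by
    rw [← φ.inner_map_map x (φ z), hφ, Submodule.reflection_reflection]
  have key := (measurePreserving_sphereHomeomorph φ).integral_comp
    (sphereHomeomorph φ).measurableEmbedding
    (fun x : Metric.sphere (0 : E) 1 => q.eval (inner ℝ (x : E) y) * inner ℝ (x : E) e)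
  simp only [coe_sphereHomeomorph, hi, he, hy, inner_neg_right, mul_neg, integral_neg] at key
  linarith

/-- Rotate the pair `y`, `e` by `θ` in its plane: `u` and `v` are the inner products with the
rotated vectors. The integral of `q(u) * v` is 0 for every `θ`, and its derivative at `θ = 0` is the
claim. -/
theorem integral_sphere_derivative (q : ℝ[X]) {y e : E} (hy : ‖y‖ = 1) (he : ‖e‖ = 1)
    (h : inner ℝ y e = 0) :
    ∫ x : Metric.sphere (0 : E) 1, (q.derivative.eval (inner ℝ (x : E) y) * inner ℝ (x : E) e ^ 2
      - q.eval (inner ℝ (x : E) y) * inner ℝ (x : E) y) ∂(volume : Measure E).toSphere = 0 := by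
  let u : ℝ → Metric.sphere (0 : E) 1 → ℝ := fun θ x =>
    Real.cos θ * inner ℝ (x : E) y + Real.sin θ * inner ℝ (x : E) e
  let v : ℝ → Metric.sphere (0 : E) 1 → ℝ := fun θ x =>
    -Real.sin θ * inner ℝ (x : E) y + Real.cos θ * inner ℝ (x : E) e
  have hu : ∀ θ x, HasDerivAt (u · x) (v θ x) θ := fun θ x =>
    ((Real.hasDerivAt_cos θ).mul_const _).add ((Real.hasDerivAt_sin θ).mul_const _)
  have hv : ∀ θ x, HasDerivAt (v · x) (-u θ x) θ := fun θ x =>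
    (((Real.hasDerivAt_sin θ).neg.mul_const (inner ℝ (x : E) y)).add
      ((Real.hasDerivAt_cos θ).mul_const (inner ℝ (x : E) e))).congr_deriv (by
        simp only [u]
        ring)
  have hcu : Continuous (Function.uncurry u) := by
    simp only [u, Function.uncurry_def]
    fun_prop
  have hcv : Continuous (Function.uncurry v) := by
    simp only [v, Function.uncurry_def]
    fun_prop
  have hd := hasDerivAt_integral_sphere (E := E) (F := fun θ x => q.eval (u θ x) * v θ x)
    (F' := fun θ x => q.derivative.eval (u θ x) * v θ x * v θ x + q.eval (u θ x) * -u θ x)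
    ((q.continuous.comp hcu).mul hcv)
    ((((q.derivative.continuous.comp hcu).mul hcv).mul hcv).add
      ((q.continuous.comp hcu).mul hcu.neg))
    (fun θ x => HasDerivAt.mul (c := fun θ => q.eval (u θ x))
      (HasDerivAt.comp (h₂ := fun t => q.eval t) (h := (u · x)) θ (q.hasDerivAt (u θ x))
        (hu θ x)) (hv θ x)) 0
  have h0 : (fun θ => ∫ x, q.eval (u θ x) * v θ x ∂(volume : Measure E).toSphere) =
      fun _ => 0 := by
    funext θ
    have horth : inner ℝ (Real.cos θ • y + Real.sin θ • e) (-Real.sin θ • y + Real.cos θ • e) =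
        (0 : ℝ) := by
      have h' : inner ℝ e y = 0 := by rw [real_inner_comm]; exact h
      simp only [inner_add_left, inner_add_right, real_inner_smul_left, real_inner_smul_right, h,
        h', real_inner_self_eq_norm_sq, hy, he]
      ring
    have := integral_sphere_mul_inner_eq_zero q horth
    simpa only [inner_add_right, real_inner_smul_right] using this
  rw [h0] at hd
  have := hd.unique (hasDerivAt_const 0 (0 : ℝ))
  rw [← this]
  congr 1
  funext x
  simp only [u, v, Real.cos_zero, Real.sin_zero]
  ring_nf

/-- The integral over the unit sphere of a polynomial in `⟨x, y⟩`. -/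
noncomputable def sphereFunctional (y : E) : ℝ[X] →ₗ[ℝ] ℝ where
  toFun p := ∫ x : Metric.sphere (0 : E) 1, p.eval (inner ℝ (x : E) y)
    ∂(volume : Measure E).toSphere
  map_add' p q := by
    simp only [Polynomial.eval_add]
    exact integral_add (integrable_sphere (by fun_prop)) (integrable_sphere (by fun_prop))
  map_smul' a p := by
    simp only [Polynomial.eval_smul, smul_eq_mul, RingHom.id_apply]
    exact integral_const_mul _ _

theorem sphereFunctional_apply (y : E) (p : ℝ[X]) :
    sphereFunctional y p = ∫ x : Metric.sphere (0 : E) 1, p.eval (inner ℝ (x : E) y)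
      ∂(volume : Measure E).toSphere := rfl

/-- Complete `y` to an orthonormal basis and sum `integral_sphere_derivative` over the other basis
vectors; on the sphere the squares of those coordinates sum to `1 - ⟨x, y⟩ ^ 2`. -/
theorem sphereFunctional_derivative {y : E} (hy : ‖y‖ = 1) (q : ℝ[X]) :
    sphereFunctional y ((1 - Polynomial.X ^ 2) * q.derivative) =
      (Module.finrank ℝ E - 1) * sphereFunctional y (Polynomial.X * q) := by
  classical
  obtain ⟨s, b, hs, hb⟩ := Orthonormal.exists_orthonormalBasis_extension (𝕜 := ℝ) (v := {y})
    (by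
      rw [orthonormal_subtype_iff_ite]
      rintro v rfl w rfl
      simp [hy])
  let i₀ : s := ⟨y, hs rfl⟩
  have hb0 : b i₀ = y := by rw [hb]
  have h1 : ∀ i ∈ Finset.univ.erase i₀, ∫ x : Metric.sphere (0 : E) 1,
      (q.derivative.eval (inner ℝ (x : E) y) * inner ℝ (x : E) (b i) ^ 2
      - q.eval (inner ℝ (x : E) y) * inner ℝ (x : E) y) ∂(volume : Measure E).toSphere = 0 :=
    fun i hi => integral_sphere_derivative q hy (b.orthonormal.1 i) (by
      rw [← hb0]
      exact b.orthonormal.2 (Finset.ne_of_mem_erase hi).symm)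
  have h2 := Finset.sum_eq_zero h1
  rw [← integral_finsetSum _ fun i _ => integrable_sphere (by fun_prop)] at h2
  rw [← sub_eq_zero, ← smul_eq_mul (Module.finrank ℝ E - 1 : ℝ),
    ← map_smul (sphereFunctional y), ← map_sub (sphereFunctional y), sphereFunctional_apply, ← h2]
  congr 1
  funext x
  have hsum : ∑ i ∈ Finset.univ.erase i₀, inner ℝ (x : E) (b i) ^ 2 = 1 - inner ℝ (x : E) y ^ 2 := by
    have := b.sum_sq_norm_inner_left (x : E)
    rw [norm_eq_of_mem_sphere x, ← Finset.add_sum_erase _ _ (Finset.mem_univ i₀), hb0] at this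
    simp only [Real.norm_eq_abs, sq_abs] at this
    linarith
  have hcard : ((Finset.univ.erase i₀).card : ℝ) = Module.finrank ℝ E - 1 := by
    rw [Finset.card_erase_of_mem (Finset.mem_univ _), Module.finrank_eq_card_basis b.toBasis,
      Finset.card_univ, Nat.cast_pred (Fintype.card_pos_iff.2 ⟨i₀⟩)]
  rw [Finset.sum_sub_distrib, ← Finset.mul_sum, hsum, Finset.sum_const, nsmul_eq_mul, hcard]
  simp
  ring

end Sphere

end SphericalDesign

/-! ### Gegenbauer means and the energy bound -/

namespace SphericalDesign

open Polynomial

variable {n : ℕ}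

theorem C_mul_gegenbauer_add_two (hn : 2 ≤ n) (i : ℕ) :
    C ((i : ℝ) + 1 + n - 2) * gegenbauer n (i + 2) =
      C (2 * ((i : ℝ) + 1) + n - 2) * X * gegenbauer n (i + 1) - C ((i : ℝ) + 1) * gegenbauer n i := by
  have : (2 : ℝ) ≤ n := by exact_mod_cast hn
  have h0 : (i : ℝ) + 1 + n - 2 ≠ 0 := by
    have := i.cast_nonneg (α := ℝ)
    linarith
  rw [gegenbauer, ← mul_assoc, ← C_mul, mul_inv_cancel₀ h0, C_1, one_mul]

/-- Puts the left side of `sphereFunctional_derivative`, for `q = P_{i+1}`, in terms of Gegenbauer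
polynomials. -/
theorem derivative_gegenbauer (hn : 2 ≤ n) (i : ℕ) :
    (1 - X ^ 2) * derivative (gegenbauer n (i + 1)) =
      C ((i : ℝ) + 1) * (gegenbauer n i - X * gegenbauer n (i + 1)) := by
  have hn' : (2 : ℝ) ≤ n := by exact_mod_cast hn
  induction i using Nat.twoStepInduction with
  | zero => simp [gegenbauer, sq]
  | one =>
    have ha : (C ((0 : ℕ) + 1 + n - 2) : ℝ[X]) ≠ 0 := by
      simp only [ne_eq, C_eq_zero]
      push_cast
      linarith
    refine mul_left_cancel₀ ha ?_
    have h := C_mul_gegenbauer_add_two hn 0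
    have hd := congrArg derivative h
    have g0 : gegenbauer n 0 = 1 := gegenbauer.eq_1 n
    have g1 : gegenbauer n 1 = X := gegenbauer.eq_2 n
    simp only [derivative_mul, derivative_sub, derivative_X, derivative_C] at hd
    simp only [C_add, C_sub, C_mul, map_natCast, map_one, map_ofNat] at h hd ⊢
    push_cast at h hd ⊢
    simp only [zero_add, g0, g1, derivative_X, derivative_one] at h hd ⊢
    linear_combination (1 - X ^ 2) * hd + 2 * X * h
  | more i h0 h1 =>
    have ha : (C (((i + 1 : ℕ) : ℝ) + 1 + n - 2) : ℝ[X]) ≠ 0 := by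
      have := i.cast_nonneg (α := ℝ)
      simp only [ne_eq, C_eq_zero]
      push_cast
      linarith
    refine mul_left_cancel₀ ha ?_
    have hr := C_mul_gegenbauer_add_two hn i
    have h := C_mul_gegenbauer_add_two hn (i + 1)
    have hd := congrArg derivative h
    simp only [derivative_mul, derivative_sub, derivative_X, derivative_C]
      at hd
    simp only [C_add, C_sub, C_mul, map_natCast, map_one, map_ofNat] at h hd hr h0 h1 ⊢
    push_cast at h hd hr h0 h1 ⊢
    linear_combination (1 - X ^ 2) * hd + ((i : ℝ[X]) + 3) * X * h +
      (2 * ((i : ℝ[X]) + 2) + n - 2) * X * h1 - ((i : ℝ[X]) + 2) * h0 -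
      ((i : ℝ[X]) + 2) * hr

section
variable {E : Type*} [NormedAddCommGroup E] [InnerProductSpace ℝ E]
  [FiniteDimensional ℝ E] [MeasurableSpace E] [BorelSpace E]

/-- Writing `L` for the functional, `h1` and `h2` make both `L(P_i)` and `L(P_{i+2})` multiples of
`L(t P_{i+1})`, so vanishing passes from degree `i` to `i + 2`. Degree 1 is the case `q = 1` of
integration by parts; in degree 2 the factor `i = 0` in `h2` suffices. -/
theorem sphereFunctional_gegenbauer (hE : Module.finrank ℝ E = n) (hn : 2 ≤ n) {y : E}
    (hy : ‖y‖ = 1) (i : ℕ) : sphereFunctional y (gegenbauer n (i + 1)) = 0 := by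
  have hn' : (2 : ℝ) ≤ n := by exact_mod_cast hn
  have hL : ∀ a p, sphereFunctional y (C a * p) = a * sphereFunctional y p := fun a p => by
    rw [C_mul', map_smul, smul_eq_mul]
  have h1 : ∀ i : ℕ, ((i : ℝ) + 1) * sphereFunctional y (gegenbauer n i) =
      (i + n) * sphereFunctional y (X * gegenbauer n (i + 1)) := fun i => by
    have := sphereFunctional_derivative hy (gegenbauer n (i + 1))
    rw [derivative_gegenbauer hn, hL, map_sub, hE] at this
    linear_combination this
  have h2 : ∀ i : ℕ, ((i : ℝ) + 1 + n - 2) * sphereFunctional y (gegenbauer n (i + 2)) =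
      i * sphereFunctional y (X * gegenbauer n (i + 1)) := fun i => by
    have := congrArg (sphereFunctional y) (C_mul_gegenbauer_add_two hn i)
    rw [map_sub (sphereFunctional y), hL, mul_assoc, hL, hL] at this
    linear_combination this - h1 i
  have hpos : ∀ i : ℕ, (i : ℝ) + 1 + n - 2 ≠ 0 := fun i => by
    have := i.cast_nonneg (α := ℝ)
    linarith
  induction i using Nat.twoStepInduction with
  | zero =>
    have := sphereFunctional_derivative hy 1
    rw [derivative_one, mul_zero, map_zero, mul_one, hE] at this
    rw [zero_add, gegenbauer.eq_2]
    exact (mul_eq_zero.1 this.symm).resolve_left (by linarith)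
  | one =>
    have := h2 0
    have hp := hpos 0
    rw [Nat.cast_zero] at hp this
    rw [zero_mul] at this
    exact (mul_eq_zero.1 this).resolve_left hp
  | more i h0 _ =>
    have h3 := h1 (i + 1)
    rw [h0, mul_zero] at h3
    have h4 := (mul_eq_zero.1 h3.symm).resolve_left (by positivity)
    have h5 := h2 (i + 1)
    rw [h4, mul_zero] at h5
    exact (mul_eq_zero.1 h5).resolve_left (hpos (i + 1))
end

theorem sum_gegenbauer_eq_zero (hn : 2 ≤ n) {τ : ℕ} {D : Finset (Sphere n)} (hD : IsDesign τ D)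
    {i : ℕ} (hi : 1 ≤ i) (hiτ : i ≤ τ) (y : Sphere n) :
    ∑ x ∈ D, (gegenbauer n i).eval (ip x y : ℝ) = 0 := by
  rcases D.eq_empty_or_nonempty with rfl | hne
  · simp
  -- On the sphere `P_i(⟨x, y⟩)` agrees with a polynomial in `x` of degree at most `i`, so the
  -- design property applies.
  have h := hD (zonal (fun j => y.1 j) i) ((zonal_isHomogeneous _ i).totalDegree_le.trans hiτ)
  obtain ⟨k, rfl⟩ := Nat.exists_eq_add_of_le' hi
  simp only [eval_zonal_sphere] at h
  have h0 := sphereFunctional_gegenbauer (finrank_euclideanSpace_fin (𝕜 := ℝ)) hn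
    (norm_eq_of_mem_sphere y) k
  rw [sphereFunctional_apply] at h0
  change _ * ∫ x : Sphere n, (gegenbauer n (k + 1)).eval (inner ℝ x.1 y.1) ∂_ = _ at h
  rw [h0, mul_zero] at h
  exact (mul_eq_zero.1 h.symm).resolve_left (by simpa using hne.ne_empty)

theorem sum_sum_eval_le (hn : 2 ≤ n) {τ : ℕ} {D : Finset (Sphere n)} (hD : IsDesign τ D)
    {g : ℝ[X]} {c : ℕ → ℝ}
    (hg : g = ∑ i ∈ Finset.range (g.natDegree + 1), C (c i) * gegenbauer n i)
    (hc : ∀ i : ℕ, τ + 1 ≤ i → i ≤ g.natDegree → c i ≤ 0) :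
    ∑ y ∈ D, ∑ x ∈ D, g.eval (ip x y : ℝ) ≤ c 0 * (D.card : ℝ) ^ 2 := by
  have h1 : ∑ y ∈ D, ∑ x ∈ D, g.eval (ip x y : ℝ) = ∑ i ∈ Finset.range (g.natDegree + 1),
      c i * ∑ y ∈ D, ∑ x ∈ D, (gegenbauer n i).eval (ip x y : ℝ) := by
    have : ∀ t : ℝ, g.eval t = ∑ i ∈ Finset.range (g.natDegree + 1),
        c i * (gegenbauer n i).eval t := fun t => by
      conv_lhs => rw [hg]
      simp [eval_finsetSum]
    simp only [this, Finset.mul_sum]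
    rw [Finset.sum_comm]
    simp_rw [Finset.sum_comm (s := D) (t := Finset.range _)]
    rw [Finset.sum_congr rfl fun i _ => Finset.sum_comm]
  rw [h1, Finset.sum_range_succ', add_comm]
  have h2 : ∀ k ∈ Finset.range g.natDegree, c (k + 1) * ∑ y ∈ D, ∑ x ∈ D,
      (gegenbauer n (k + 1)).eval (ip x y : ℝ) ≤ 0 := fun k hk => by
    rcases le_or_gt (k + 1) τ with hk' | hk'
    · simp [sum_gegenbauer_eq_zero hn hD (Nat.le_add_left 1 k) hk']
    · exact mul_nonpos_of_nonpos_of_nonneg (hc _ hk' (Finset.mem_range.1 hk))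
        (sum_gegenbauer_nonneg hn D _)
  have h3 := Finset.sum_nonpos h2
  simp only [gegenbauer.eq_1, eval_one, Finset.sum_const, nsmul_eq_mul, mul_one]
  linarith [sq (D.card : ℝ)]

theorem ip_self (x : Sphere n) : (ip x x : ℝ) = 1 := by
  rw [ip_eq_sum, sum_mul_self_sphere]

theorem energy_le (hn : 2 ≤ n) {τ : ℕ} {D : Finset (Sphere n)} (hD : IsDesign τ D)
    {g : ℝ[X]} {c : ℕ → ℝ}
    (hg : g = ∑ i ∈ Finset.range (g.natDegree + 1), C (c i) * gegenbauer n i)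
    (hc : ∀ i : ℕ, τ + 1 ≤ i → i ≤ g.natDegree → c i ≤ 0) {h : Set.Icc (-1 : ℝ) 1 → ℝ≥0∞}
    (hh : ∀ x ∈ D, ∀ y ∈ D, x ≠ y → (h (ip x y) : EReal) ≤ ((g.eval (ip x y : ℝ) : ℝ) : EReal)) :
    (energy D h : EReal) ≤ (((D.card : ℝ) * (c 0 * D.card - g.eval 1) : ℝ) : EReal) := by
  classical
  have hsum : ∑ p ∈ D.offDiag, g.eval (ip p.1 p.2 : ℝ) ≤
      (D.card : ℝ) * (c 0 * D.card - g.eval 1) := by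
    have h1 := sum_sum_eval_le hn hD hg hc
    have h2 : ∑ y ∈ D, ∑ x ∈ D, g.eval (ip x y : ℝ) =
        ∑ p ∈ D.diag, g.eval (ip p.1 p.2 : ℝ) + ∑ p ∈ D.offDiag, g.eval (ip p.1 p.2 : ℝ) := by
      rw [← Finset.sum_union (Finset.disjoint_diag_offDiag D), Finset.diag_union_offDiag,
        Finset.sum_product_right]
    rw [h2, Finset.sum_diag] at h1
    simp only [ip_self, Finset.sum_const, nsmul_eq_mul] at h1
    linarith
  have hcast : (energy D h : EReal) = ∑ p ∈ D.offDiag, (h (ip p.1 p.2) : EReal) := by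
    rw [energy]
    -- The coercion is bundled as an additive homomorphism so that it passes through the finite sum.
    exact map_sum (⟨⟨(↑), EReal.coe_ennreal_zero⟩, EReal.coe_ennreal_add⟩ : ℝ≥0∞ →+ EReal) _ _
  rw [hcast]
  refine le_trans (Finset.sum_le_sum fun p hp => ?_)
    (le_trans (map_sum (⟨⟨(↑), EReal.coe_zero⟩, EReal.coe_add⟩ : ℝ →+ EReal) _ _).ge
      (EReal.coe_le_coe_iff.2 hsum))
  obtain ⟨hx, hy, hxy⟩ := Finset.mem_offDiag.1 hp
  exact hh _ hx _ hy hxy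

theorem ip_mem_innerInterval {N τ : ℕ} {D : Finset (Sphere n)} (hD : IsDesign τ D)
    (hN : D.card = N) {x y : Sphere n} (hx : x ∈ D) (hy : y ∈ D) (hxy : x ≠ y) :
    (ip x y : ℝ) ∈ innerInterval n N τ := by
  classical
  have hp : (x, y) ∈ D.offDiag := Finset.mem_offDiag.2 ⟨hx, hy, hxy⟩
  constructor
  · have hle : lowerInner n N τ ≤ minInner D := sInf_le ⟨D, hD, hN, rfl⟩
    refine hle.trans ?_
    unfold minInner
    convert Finset.inf_le (f := fun p : Sphere n × Sphere n => ((ip p.1 p.2 : ℝ) : EReal)) hp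
  · have hle : maxInner D ≤ upperInner n N τ := le_sSup ⟨D, hD, hN, rfl⟩
    refine le_trans ?_ hle
    unfold maxInner
    convert Finset.le_sup (f := fun p : Sphere n × Sphere n => ((ip p.1 p.2 : ℝ) : EReal)) hp

end SphericalDesign

theorem theorem3p6 (n N τ : ℕ) (hn : 2 ≤ n) (hN : 0 < N) (hτ : 0 < τ)
    (hD : SphericalDesign.dgs n τ ≤ N)
    (h : Set.Icc (-1 : ℝ) 1 → ℝ≥0∞)
    (g : ℝ[X]) (c : ℕ → ℝ)
    (hg : g = ∑ i ∈ Finset.range (g.natDegree + 1),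
      Polynomial.C (c i) * SphericalDesign.gegenbauer n i)
    (hB2 : ∀ i : ℕ, τ + 1 ≤ i → i ≤ g.natDegree → c i ≤ 0) :
    (∀ I : Set ℝ, I ⊆ Set.Ico (-1 : ℝ) 1 →
      (∀ t : Set.Icc (-1 : ℝ) 1, (t : ℝ) ∈ I → (h t : EReal) ≤ ((g.eval (t : ℝ) : ℝ) : EReal)) →
      ∀ C : Finset (SphericalDesign.Sphere n), SphericalDesign.IsDesign τ C → C.card = N →
        (∀ x ∈ C, ∀ y ∈ C, x ≠ y → (SphericalDesign.ip x y : ℝ) ∈ I) →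
        (SphericalDesign.energy C h : EReal) ≤
          (((N : ℝ) * (c 0 * (N : ℝ) - g.eval 1) : ℝ) : EReal)) ∧
    ((∀ t : Set.Icc (-1 : ℝ) 1, (t : ℝ) ∈ SphericalDesign.innerInterval n N τ →
        (h t : EReal) ≤ ((g.eval (t : ℝ) : ℝ) : EReal)) →
      SphericalDesign.maxEnergy n N τ h ≤
        (((N : ℝ) * (c 0 * (N : ℝ) - g.eval 1) : ℝ) : EReal)) := by
  refine ⟨fun I _ hI D hdes hcard hDI => ?_, fun hI => sSup_le ?_⟩
  · subst hcard
    exact SphericalDesign.energy_le hn hdes hg hB2 fun x hx y hy hxy => hI _ (hDI x hx y hy hxy)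
  · rintro _ ⟨D, hdes, rfl, rfl⟩
    exact SphericalDesign.energy_le hn hdes hg hB2 fun x hx y hy hxy =>
      hI _ (SphericalDesign.ip_mem_innerInterval hdes rfl hx hy hxy)
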